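/- **Setting.** Fix the number $N$ of actions. In each round $t = 1, 2, \ldots$ the player chooses a probability vector $p_t \in \{p \in [0,1]^N : \|p\|_1 = 1\}$, then the environment chooses a loss vector $\ell_t \in [0,1]^N$, and then the player observes all of $\ell_t$. An *algorithm* (for the expert problem) chooses $p_t$ as a measurable function of $\ell_1, \ldots, \ell_{t-1}$ and of internal randomness; an *environment* chooses $\ell_t$ as a measurable function of $p_1, \ldots, p_t$ and of internal randomness that is independent of the player's. The *pseudo-regret* against action $i^* \in [N]$ over $T$ rounds is $$\bar R_{Ti^*} = \mathbb{E}\Big[\sum_{t=1}^T \big(\ell_t^\top p_t - \ell_{ti^*}\big)\Big].$$ The environment is in the *adversarial regime with an $(i^*, \Delta, C, T)$ self-bounding constraint* if, for every algorithm, $$\bar R_{Ti^*} \ \ge\ \Delta \cdot \mathbb{E}\Big[\sum_{t=1}^T (1 - p_{ti^*})\Big] - C .$$ **Theorem.** There is a universal constant $c > 0$ such that for all $\Delta \in (0, 1/4)$, all integers $N \ge 4$ and $T \ge 4 \log N$, all real $C \ge 0$, and every (possibly randomized) algorithm for the expert problem with $N$ actions, there exist an action $i^* \in [N]$ and an environment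 in the adversarial regime with an $(i^*, \Delta, C, T)$ self-bounding constraint for which the pseudo-regret of the algorithm satisfies $$\bar R_{Ti^*} \ \ge\ c \cdot \min\left\{ \frac{\log N}{\Delta} + \sqrt{\frac{C \log N}{\Delta}},\ \sqrt{T \log N} \right\}.$$ -/

import Mathlib

open MeasureTheory

noncomputable section

namespace Experts

/-- Loss vectors `ℓ ∈ [0, 1]^N`. -/
abbrev LossVec (N : ℕ) : Type := Fin N → unitInterval

/-- Probability vectors over the `N` actions. -/
abbrev ProbVec (N : ℕ) : Type := stdSimplex ℝ (Fin N)

/-- A (possibly randomized) algorithm for the expert problem with `N` actions. Its internal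
randomness is a seed drawn from `seedLaw`. Rounds are numbered `0, 1, 2, …`: in round `t` the
probability vector is a measurable function of the seed and of all the loss vectors of the
rounds before `t`. -/
structure Algorithm (N : ℕ) where
  Seed : Type
  [measSeed : MeasurableSpace Seed]
  seedLaw : Measure Seed
  [isProb : IsProbabilityMeasure seedLaw]
  act : (t : ℕ) → Seed → (Fin t → LossVec N) → ProbVec N
  measurable_act : ∀ t, Measurable fun x : Seed × (Fin t → LossVec N) => act t x.1 x.2

attribute [instance] Algorithm.measSeed Algorithm.isProb

/-- A (possibly randomized and adaptive) environment. Its internal randomness is a sample drawn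
from `law`. In round `t` the loss vector is a measurable function of the sample and of the
probability vectors chosen by the player in the rounds `0, …, t` (the current one included). -/
structure Environment (N : ℕ) where
  Sample : Type
  [measSample : MeasurableSpace Sample]
  law : Measure Sample
  [isProb : IsProbabilityMeasure law]
  loss : (t : ℕ) → Sample → (Fin (t + 1) → ProbVec N) → LossVec N
  measurable_loss :
    ∀ t, Measurable fun x : Sample × (Fin (t + 1) → ProbVec N) => loss t x.1 x.2

attribute [instance] Environment.measSample Environment.isProb

variable {N : ℕ}

/-- The probability vectors and the loss vectors of the first `t` rounds. -/
def history (A : Algorithm N) (E : Environment N) (ω : A.Seed × E.Sample) :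
    (t : ℕ) → (Fin t → ProbVec N) × (Fin t → LossVec N)
  | 0 => (Fin.elim0, Fin.elim0)
  | t + 1 =>
    let h := history A E ω t
    let p : Fin (t + 1) → ProbVec N := Fin.snoc h.1 (A.act t ω.1 h.2)
    (p, Fin.snoc h.2 (E.loss t ω.2 p))

/-- The probability vector `p_t` that the player chooses in round `t`. -/
def prob (A : Algorithm N) (E : Environment N) (ω : A.Seed × E.Sample) (t : ℕ) : ProbVec N :=
  (history A E ω (t + 1)).1 (Fin.last t)

/-- The loss vector `ℓ_t` that the environment chooses in round `t`. -/
def lossVec (A : Algorithm N) (E : Environment N) (ω : A.Seed × E.Sample) (t : ℕ) : LossVec N :=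
  (history A E ω (t + 1)).2 (Fin.last t)

/-- The joint law of the randomness: the seed of the player and the sample of the environment are
independent. -/
def jointLaw (A : Algorithm N) (E : Environment N) : Measure (A.Seed × E.Sample) :=
  A.seedLaw.prod E.law

/-- The regret `R_{Ti} = ∑_t ⟨ℓ_t, p_t⟩ - ∑_t ℓ_{ti}` over `T` rounds against action `i`. -/
def regret (A : Algorithm N) (E : Environment N) (T : ℕ) (i : Fin N)
    (ω : A.Seed × E.Sample) : ℝ :=
  ∑ t ∈ Finset.range T, ∑ j, (lossVec A E ω t j : ℝ) * (prob A E ω t).1 j -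
    ∑ t ∈ Finset.range T, (lossVec A E ω t i : ℝ)

/-- The pseudo-regret `E[R_{Ti}]`. -/
def pseudoRegret (A : Algorithm N) (E : Environment N) (T : ℕ) (i : Fin N) : ℝ :=
  ∫ ω, regret A E T i ω ∂(jointLaw A E)

/-- The environment is in the adversarial regime with an `(i, Δ, C, T)` self-bounding constraint:
against every algorithm, `E[R_{Ti}] ≥ Δ · E[∑_t (1 - p_{ti})] - C`. -/
def Environment.SelfBounding (E : Environment N) (i : Fin N) (Δ C : ℝ) (T : ℕ) : Prop :=
  ∀ A : Algorithm N,
    Δ * (∫ ω, ∑ t ∈ Finset.range T, (1 - (prob A E ω t).1 i) ∂(jointLaw A E)) - C ≤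
      pseudoRegret A E T i

end Experts

end

noncomputable section

namespace Experts

variable {N n : ℕ}

/-! The hard environment is oblivious. For `n` rounds all losses are independent fair bits, except
that action `i` has loss `1` with probability `1/2 - ε`; afterwards `i` has loss `0` and the others
`1`. The round regret is on average `ε` (later `1`) times the mass missing from `i`
(`integral_roundRegret`), so the self-bounding constraint costs at most `n * max (Δ - ε) 0`
(`hardEnv_selfBounding`).

While `ε ^ 2 * n ≤ log N / 8`, the biased law has second moment at most `√N` relative to the fair
law. A player cannot then find `i` for all `i` at once (`sum_sum_weight_mul_le`), and some `i`
forces regret at least `ε * n / 4` (`exists_quarter_le_pseudoRegret`). With `ε` of order `√(log N /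
n)` this is of order `√(n log N)`. The constraint allows `n` of order `log N / Δ ^ 2` (then `Δ ≤ ε`)
or `C / Δ` (paid from `C`), cut off at `T` (`exists_rounds_bias`). -/

/-! ### Fair and biased bits -/

/-- The loss bits of `n` rounds for `N` actions. -/
abbrev Bits (n N : ℕ) : Type := Fin n → Fin N → Bool

/-- The sign of a bit: `true ↦ 1`, `false ↦ -1`. -/
def sgn (b : Bool) : ℝ := if b then 1 else -1

lemma sgn_not (b : Bool) : sgn (!b) = -sgn b := by cases b <;> simp [sgn]

lemma sgn_mul_self (b : Bool) : sgn b * sgn b = 1 := by cases b <;> simp [sgn]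

/-- Flip the bit of action `j` in round `t`. -/
def flipBit (t : Fin n) (j : Fin N) (x : Bits n N) : Bits n N :=
  fun s k => if s = t ∧ k = j then !x s k else x s k

lemma flipBit_involutive (t : Fin n) (j : Fin N) : Function.Involutive (flipBit t j) := by
  intro x
  funext s k
  by_cases h : s = t ∧ k = j <;> simp [flipBit, h]

lemma flipBit_self (t : Fin n) (j : Fin N) (x : Bits n N) : flipBit t j x t j = !x t j := by
  simp [flipBit]

lemma flipBit_of_round_ne {s t : Fin n} (h : s ≠ t) (j : Fin N) (x : Bits n N) :
    flipBit t j x s = x s := by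
  funext k
  simp [flipBit, h]

lemma flipBit_of_action_ne {j k : Fin N} (h : k ≠ j) (s t : Fin n) (x : Bits n N) :
    flipBit t j x s k = x s k := by
  simp [flipBit, h]

/-- Flipping a bit permutes the outcomes; this symmetry stands in for independence arguments. -/
lemma sum_eq_zero_of_flipBit_neg (t : Fin n) (j : Fin N) {h : Bits n N → ℝ}
    (hh : ∀ x, h (flipBit t j x) = -h x) : ∑ x, h x = 0 := by
  have := Equiv.sum_comp (flipBit_involutive t j).toPerm h
  simp only [Function.Involutive.coe_toPerm, hh, Finset.sum_neg_distrib] at this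
  linarith

lemma sum_bits_apply (f : Bool → ℝ) (i : Fin N) :
    ∑ y : Fin N → Bool, f (y i) = 2 ^ N * ((f true + f false) / 2) := by
  have hinv : Function.Involutive fun y : Fin N → Bool => fun k => !y k := fun y => by simp
  have h1 := Equiv.sum_comp hinv.toPerm fun y => f (y i)
  simp only [Function.Involutive.coe_toPerm] at h1
  have h2 : ∑ y : Fin N → Bool, (f (y i) + f (!y i)) = 2 ^ N * (f true + f false) := by
    have : ∀ b : Bool, f b + f (!b) = f true + f false := by
      intro b; cases b <;> simp [add_comm]
    simp [this, mul_add]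
  rw [Finset.sum_add_distrib, h1] at h2
  linarith

lemma sum_prod_bits (f : Bool → ℝ) (i : Fin N) :
    ∑ x : Bits n N, ∏ t, f (x t i) = (2 ^ N * ((f true + f false) / 2)) ^ n := by
  rw [← sum_bits_apply f i, Fintype.sum_pow]

/-- The likelihood ratio of biased bits for action `i` with respect to fair bits. -/
def likelihood (ε : ℝ) (i : Fin N) (x : Bits n N) : ℝ := ∏ t, (1 - 2 * ε * sgn (x t i))

/-- The probability of `x` when all bits are independent and fair, except those of action `i`,
which equal `true` with probability `1 / 2 - ε`. -/
def weight (ε : ℝ) (i : Fin N) (x : Bits n N) : ℝ := ((2 ^ N) ^ n)⁻¹ * likelihood ε i x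

lemma weight_nonneg {ε : ℝ} (h0 : 0 ≤ ε) (h1 : ε ≤ 1 / 2) (i : Fin N) (x : Bits n N) :
    0 ≤ weight ε i x := by
  refine mul_nonneg (by positivity) (Finset.prod_nonneg fun t _ => ?_)
  cases x t i <;> simp [sgn] <;> linarith

lemma sum_weight (ε : ℝ) (i : Fin N) : ∑ x : Bits n N, weight ε i x = 1 := by
  simp only [weight, likelihood, ← Finset.mul_sum]
  rw [sum_prod_bits (fun b => 1 - 2 * ε * sgn b)]
  have : ((1 - 2 * ε * sgn true) + (1 - 2 * ε * sgn false)) / 2 = 1 := by simp [sgn]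
  rw [this, mul_one]
  exact inv_mul_cancel₀ (by positivity)

/-- Second moment under the fair law (chi-square divergence plus one): each round contributes a
factor `1 + 4 * ε ^ 2`. -/
lemma sum_likelihood_sq (ε : ℝ) (i : Fin N) :
    ((2 ^ N) ^ n : ℝ)⁻¹ * ∑ x : Bits n N, likelihood ε i x ^ 2 = (1 + 4 * ε ^ 2) ^ n := by
  simp only [likelihood, ← Finset.prod_pow]
  rw [sum_prod_bits (fun b => (1 - 2 * ε * sgn b) ^ 2)]
  have : ((1 - 2 * ε * sgn true) ^ 2 + (1 - 2 * ε * sgn false) ^ 2) / 2 = 1 + 4 * ε ^ 2 := by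
    simp [sgn]; ring
  rw [this, mul_pow, ← mul_assoc, inv_mul_cancel₀ (by positivity), one_mul]

lemma weight_flipBit_of_ne (ε : ℝ) {i j : Fin N} (h : i ≠ j) (t : Fin n) (x : Bits n N) :
    weight ε i (flipBit t j x) = weight ε i x := by
  simp only [weight, likelihood, flipBit_of_action_ne h]

lemma sum_weight_mul_sgn_of_ne (ε : ℝ) {i j : Fin N} (h : i ≠ j) (t : Fin n)
    {q : Bits n N → ℝ} (hq : ∀ x, q (flipBit t j x) = q x) :
    ∑ x, weight ε i x * (sgn (x t j) * q x) = 0 := by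
  refine sum_eq_zero_of_flipBit_neg t j fun x => ?_
  rw [weight_flipBit_of_ne ε h, flipBit_self, sgn_not, hq]
  ring

lemma sum_weight_mul_sgn_self (ε : ℝ) (i : Fin N) (t : Fin n)
    {q : Bits n N → ℝ} (hq : ∀ x, q (flipBit t i x) = q x) :
    ∑ x, weight ε i x * (sgn (x t i) * q x) = -2 * ε * ∑ x, weight ε i x * q x := by
  -- Centring makes the summand odd in the bit: `(1 - 2εs)(s + 2ε) = (1 - 4ε²)s` when `s² = 1`.
  have key : ∑ x, weight ε i x * ((sgn (x t i) + 2 * ε) * q x) = 0 := by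
    refine sum_eq_zero_of_flipBit_neg t i fun x => ?_
    have hsplit : ∀ y : Bits n N, weight ε i y = ((2 ^ N) ^ n)⁻¹ *
        ((1 - 2 * ε * sgn (y t i)) * ∏ s ∈ Finset.univ.erase t, (1 - 2 * ε * sgn (y s i))) := by
      intro y
      rw [weight, likelihood,
        ← Finset.mul_prod_erase _ (fun s => 1 - 2 * ε * sgn (y s i)) (Finset.mem_univ t)]
    have hrest : ∏ s ∈ Finset.univ.erase t, (1 - 2 * ε * sgn (flipBit t i x s i)) =
        ∏ s ∈ Finset.univ.erase t, (1 - 2 * ε * sgn (x s i)) :=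
      Finset.prod_congr rfl fun s hs => by
        rw [flipBit_of_round_ne (Finset.ne_of_mem_erase hs)]
    rw [hsplit, hsplit, hrest, flipBit_self, sgn_not, hq]
    have := sgn_mul_self (x t i)
    linear_combination (-4 * ε * (((2 ^ N) ^ n)⁻¹ *
      (∏ s ∈ Finset.univ.erase t, (1 - 2 * ε * sgn (x s i))) * q x)) * this
  rw [Finset.mul_sum, ← sub_eq_zero, ← Finset.sum_sub_distrib, ← key]
  exact Finset.sum_congr rfl fun x _ => by ring

/-- The expected regret of a round in which the strategy `p` does not depend on the bits of the
round. -/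
lemma sum_weight_mul_round_regret (ε : ℝ) (i : Fin N) (t : Fin n) {p : Bits n N → Fin N → ℝ}
    (hp : ∀ x, ∑ j, p x j = 1) (hflip : ∀ j x, p (flipBit t j x) = p x) :
    ∑ x, weight ε i x * (∑ j, (1 + sgn (x t j)) / 2 * p x j - (1 + sgn (x t i)) / 2) =
      ε * ∑ x, weight ε i x * (1 - p x i) := by
  have h1 : ∀ x, weight ε i x *
      (∑ j, (1 + sgn (x t j)) / 2 * p x j - (1 + sgn (x t i)) / 2) =
      ∑ j, (weight ε i x * (sgn (x t j) * p x j)) / 2 - weight ε i x * (sgn (x t i) * 1) / 2 := by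
    intro x
    have : ∑ j, (1 + sgn (x t j)) / 2 * p x j =
        (∑ j, p x j) / 2 + ∑ j, (sgn (x t j) * p x j) / 2 := by
      rw [Finset.sum_div, ← Finset.sum_add_distrib]
      exact Finset.sum_congr rfl fun j _ => by ring
    rw [this, hp, mul_sub, mul_add, Finset.mul_sum]
    simp only [mul_div_assoc]
    ring
  simp only [h1]
  rw [Finset.sum_sub_distrib, Finset.sum_comm, ← Finset.sum_div,
    sum_weight_mul_sgn_self ε i t (q := fun _ => 1) (fun _ => rfl),
    Finset.sum_eq_single i]
  · rw [← Finset.sum_div, sum_weight_mul_sgn_self ε i t (fun x => by rw [hflip])]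
    simp only [mul_sub, Finset.sum_sub_distrib]
    ring
  · intro j _ hj
    rw [← Finset.sum_div, sum_weight_mul_sgn_of_ne ε hj.symm t (fun x => by rw [hflip]), zero_div]
  · simp

/-- A strategy cannot put much weight on the biased action, on average over that action. -/
lemma sum_sum_weight_mul_le (ε : ℝ) {lam : ℝ} (hlam : 0 < lam) {p : Bits n N → Fin N → ℝ}
    (hp0 : ∀ x j, 0 ≤ p x j) (hp : ∀ x, ∑ j, p x j = 1) :
    ∑ i, ∑ x, weight ε i x * p x i ≤ (lam + N * (1 + 4 * ε ^ 2) ^ n / lam) / 2 := by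
  have hp1 : ∀ x j, p x j ≤ 1 := fun x j =>
    (hp x) ▸ Finset.single_le_sum (f := p x) (fun k _ => hp0 x k) (Finset.mem_univ j)
  have h1 : ∀ i x, weight ε i x * p x i ≤
      ((2 ^ N) ^ n : ℝ)⁻¹ * ((lam * p x i + likelihood ε i x ^ 2 / lam) / 2) := by
    intro i x
    rw [weight, mul_assoc]
    refine mul_le_mul_of_nonneg_left ?_ (by positivity)
    -- Making the AM-GM bound linear in `p` lets the sum over `i` use that `p` has total mass `1`.
    have h2 : p x i ^ 2 ≤ p x i := by nlinarith [hp0 x i, hp1 x i]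
    have h3 : 0 ≤ (lam * p x i - likelihood ε i x) ^ 2 / lam := by positivity
    have h4 : (lam * p x i - likelihood ε i x) ^ 2 / lam =
        lam * p x i ^ 2 - 2 * (likelihood ε i x * p x i) + likelihood ε i x ^ 2 / lam := by
      field_simp
      ring
    have h5 : lam * p x i ^ 2 ≤ lam * p x i := mul_le_mul_of_nonneg_left h2 hlam.le
    linarith
  have hL := fun i : Fin N => sum_likelihood_sq (n := n) ε i
  have hcard : ((2 ^ N) ^ n : ℝ)⁻¹ * ∑ _x : Bits n N, (1 : ℝ) = 1 := by simp
  calc ∑ i, ∑ x, weight ε i x * p x i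
      ≤ ∑ i, ∑ x, ((2 ^ N) ^ n : ℝ)⁻¹ * ((lam * p x i + likelihood ε i x ^ 2 / lam) / 2) :=
        Finset.sum_le_sum fun i _ => Finset.sum_le_sum fun x _ => h1 i x
    _ = lam / 2 * (((2 ^ N) ^ n : ℝ)⁻¹ * ∑ x : Bits n N, ∑ i, p x i) +
        (∑ i : Fin N, ((2 ^ N) ^ n : ℝ)⁻¹ * ∑ x : Bits n N, likelihood ε i x ^ 2) / lam / 2 := by
        rw [Finset.sum_comm (f := fun (x : Bits n N) i => p x i)]
        simp only [Finset.mul_sum, Finset.sum_div]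
        rw [← Finset.sum_add_distrib]
        refine Finset.sum_congr rfl fun i _ => ?_
        rw [← Finset.sum_add_distrib]
        exact Finset.sum_congr rfl fun x _ => by ring
    _ = (lam + N * (1 + 4 * ε ^ 2) ^ n / lam) / 2 := by
        simp only [hp, hL]
        rw [hcard]
        simp
        ring

/-! ### The hard environment -/

/-- The loss encoded by a bit. -/
def bitLoss (b : Bool) : unitInterval := if b then 1 else 0

lemma coe_bitLoss (b : Bool) : (bitLoss b : ℝ) = (1 + sgn b) / 2 := by
  cases b <;> simp [bitLoss, sgn]

/-- The losses are given by the bits in the first `n` rounds; afterwards action `i` has loss `0`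
and all others have loss `1`. -/
def lossSeq (i : Fin N) (x : Bits n N) (t : ℕ) : LossVec N := fun j =>
  if h : t < n then bitLoss (x ⟨t, h⟩ j) else if j = i then 0 else 1

/-- The losses of the first `t ≤ n` rounds. -/
def bitHistory (x : Bits n N) (t : ℕ) (ht : t ≤ n) : Fin t → LossVec N :=
  fun k j => bitLoss (x ⟨k, k.2.trans_le ht⟩ j)

lemma lossSeq_eq_bitHistory (i : Fin N) (x : Bits n N) (t : ℕ) (ht : t ≤ n) :
    (fun k : Fin t => lossSeq i x k) = bitHistory x t ht := by
  funext k j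
  simp [lossSeq, bitHistory, k.2.trans_le ht]

/-- The player sees only earlier rounds, so the strategy of round `t` ignores the bits of round `t`.
-/
lemma bitHistory_flipBit (x : Bits n N) (t : Fin n) (j : Fin N) :
    bitHistory (flipBit t j x) t t.2.le = bitHistory x t t.2.le := by
  funext k l
  rw [bitHistory, bitHistory, flipBit_of_round_ne]
  exact fun h => absurd (congrArg Fin.val h) k.2.ne

/-- The law of the bits of which those of action `i` are biased. -/
def bitLaw (ε : ℝ) (i : Fin N) : Measure (Bits n N) :=
  ∑ x, ENNReal.ofReal (weight ε i x) • Measure.dirac x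

lemma isProbabilityMeasure_bitLaw {ε : ℝ} (h0 : 0 ≤ ε) (h1 : ε ≤ 1 / 2) (i : Fin N) :
    IsProbabilityMeasure (bitLaw ε i : Measure (Bits n N)) := by
  constructor
  simp only [bitLaw, Measure.coe_finsetSum, Finset.sum_apply, Measure.smul_apply, measure_univ,
    smul_eq_mul, mul_one]
  rw [← ENNReal.ofReal_sum_of_nonneg fun x _ => weight_nonneg h0 h1 i x, sum_weight,
    ENNReal.ofReal_one]

lemma integral_bitLaw {ε : ℝ} (h0 : 0 ≤ ε) (h1 : ε ≤ 1 / 2) (i : Fin N) (f : Bits n N → ℝ) :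
    ∫ x, f x ∂(bitLaw ε i) = ∑ x, weight ε i x * f x := by
  rw [bitLaw, integral_finsetSum_measure]
  · refine Finset.sum_congr rfl fun x _ => ?_
    rw [integral_smul_measure, integral_dirac, ENNReal.toReal_ofReal (weight_nonneg h0 h1 i x),
      smul_eq_mul]
  · intro x _
    exact (integrable_dirac (by simp)).smul_measure ENNReal.ofReal_ne_top

/-- The hard environment: biased bits for `n` rounds, then deterministic losses favouring `i`. -/
abbrev hardEnv (n : ℕ) {ε : ℝ} (h0 : 0 ≤ ε) (h1 : ε ≤ 1 / 2) (i : Fin N) : Environment N where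
  Sample := Bits n N
  law := bitLaw ε i
  isProb := isProbabilityMeasure_bitLaw h0 h1 i
  loss t x _ := lossSeq i x t
  measurable_loss t := (measurable_of_finite fun x : Bits n N => lossSeq i x t).comp measurable_fst

/-! ### Regret and self-bounding in the hard environment -/

section Game

variable (A : Algorithm N) {ε : ℝ} (h0 : 0 ≤ ε) (h1 : ε ≤ 1 / 2) (i : Fin N)

lemma history_hardEnv_snd (ω : A.Seed × Bits n N) (t : ℕ) :
    (history A (hardEnv n h0 h1 i) ω t).2 = fun k : Fin t => lossSeq i ω.2 k := by
  induction t with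
  | zero => exact funext fun k => k.elim0
  | succ t ih =>
    funext k
    refine Fin.lastCases ?_ (fun k => ?_) k
    · simp [history, hardEnv]
    · simp [history, ih]

lemma lossVec_hardEnv (ω : A.Seed × Bits n N) (t : ℕ) :
    lossVec A (hardEnv n h0 h1 i) ω t = lossSeq i ω.2 t := by
  simp [lossVec, history_hardEnv_snd]

lemma prob_hardEnv (ω : A.Seed × Bits n N) (t : ℕ) :
    prob A (hardEnv n h0 h1 i) ω t = A.act t ω.1 fun k : Fin t => lossSeq i ω.2 k := by
  simp [prob, history, history_hardEnv_snd]

lemma prob_hardEnv_of_le (ω : A.Seed × Bits n N) {t : ℕ} (ht : t ≤ n) :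
    prob A (hardEnv n h0 h1 i) ω t = A.act t ω.1 (bitHistory ω.2 t ht) := by
  rw [prob_hardEnv, lossSeq_eq_bitHistory]

lemma measurable_prob_hardEnv (t : ℕ) (j : Fin N) :
    Measurable fun ω : A.Seed × Bits n N => (prob A (hardEnv n h0 h1 i) ω t).1 j := by
  refine measurable_from_prod_countable_left fun x => ?_
  simp only [prob_hardEnv]
  have : Measurable fun s => A.act t s fun k : Fin t => lossSeq i x k :=
    (A.measurable_act t).comp (measurable_id.prodMk measurable_const)
  exact (measurable_pi_apply j).comp (measurable_subtype_coe.comp this)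

lemma probVec_le_one (p : ProbVec N) (j : Fin N) : p.1 j ≤ 1 :=
  p.2.2 ▸ Finset.single_le_sum (f := p.1) (fun k _ => p.2.1 k) (Finset.mem_univ j)

instance : IsProbabilityMeasure (jointLaw A (hardEnv n h0 h1 i)) := by
  have := isProbabilityMeasure_bitLaw (n := n) h0 h1 i
  exact inferInstanceAs (IsProbabilityMeasure (A.seedLaw.prod (bitLaw (n := n) ε i)))

lemma integrable_one_sub_prob (t : ℕ) :
    Integrable (fun ω => 1 - (prob A (hardEnv n h0 h1 i) ω t).1 i)
      (jointLaw A (hardEnv n h0 h1 i)) := by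
  refine Integrable.of_bound
    (measurable_const.sub (measurable_prob_hardEnv A h0 h1 i t i)).aestronglyMeasurable 1
    (ae_of_all _ fun ω => ?_)
  have := probVec_le_one (prob A (hardEnv n h0 h1 i) ω t) i
  have := (prob A (hardEnv n h0 h1 i) ω t).2.1 i
  rw [Real.norm_eq_abs, abs_le]
  constructor <;> linarith

/-- The regret of round `t`. -/
def roundRegret (E : Environment N) (t : ℕ) (ω : A.Seed × E.Sample) : ℝ :=
  ∑ j, (lossVec A E ω t j : ℝ) * (prob A E ω t).1 j - (lossVec A E ω t i : ℝ)

lemma regret_eq_sum (E : Environment N) (T : ℕ) (ω : A.Seed × E.Sample) :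
    regret A E T i ω = ∑ t ∈ Finset.range T, roundRegret A i E t ω := by
  simp only [regret, roundRegret, Finset.sum_sub_distrib]

lemma integrable_roundRegret (t : ℕ) :
    Integrable (roundRegret A i (hardEnv n h0 h1 i) t) (jointLaw A (hardEnv n h0 h1 i)) := by
  have hl : ∀ j, Measurable fun ω : A.Seed × Bits n N => (lossSeq i ω.2 t j : ℝ) := fun j =>
    (measurable_of_finite fun x : Bits n N => (lossSeq i x t j : ℝ)).comp measurable_snd
  refine Integrable.of_bound (Measurable.aestronglyMeasurable ?_) 1 (ae_of_all _ fun ω => ?_)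
  · unfold roundRegret
    simp only [lossVec_hardEnv]
    exact (Finset.measurable_sum _ fun j _ =>
      (hl j).mul (measurable_prob_hardEnv A h0 h1 i t j)).sub (hl i)
  · set p := prob A (hardEnv n h0 h1 i) ω t with hp
    set l := lossVec A (hardEnv n h0 h1 i) ω t with hl
    have ha : 0 ≤ ∑ j, (l j : ℝ) * p.1 j :=
      Finset.sum_nonneg fun j _ => mul_nonneg (l j).2.1 (p.2.1 j)
    have hb : ∑ j, (l j : ℝ) * p.1 j ≤ 1 := by
      rw [← p.2.2]
      exact Finset.sum_le_sum fun j _ => mul_le_of_le_one_left (p.2.1 j) (l j).2.2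
    have hc := (l i).2.1
    have hd := (l i).2.2
    rw [roundRegret, ← hp, ← hl, Real.norm_eq_abs, abs_le]
    constructor <;> linarith

lemma integral_jointLaw {f : A.Seed × Bits n N → ℝ}
    (hf : Integrable f (jointLaw A (hardEnv n h0 h1 i))) :
    ∫ ω, f ω ∂(jointLaw A (hardEnv n h0 h1 i)) =
      ∫ s, ∑ x, weight ε i x * f (s, x) ∂A.seedLaw := by
  have := isProbabilityMeasure_bitLaw (n := n) h0 h1 i
  refine (integral_prod f hf).trans ?_
  exact integral_congr_ae (ae_of_all _ fun s => integral_bitLaw h0 h1 i _)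

lemma integral_roundRegret (t : ℕ) :
    ∫ ω, roundRegret A i (hardEnv n h0 h1 i) t ω ∂(jointLaw A (hardEnv n h0 h1 i)) =
      (if t < n then ε else 1) *
        ∫ ω, (1 - (prob A (hardEnv n h0 h1 i) ω t).1 i) ∂(jointLaw A (hardEnv n h0 h1 i)) := by
  split_ifs with ht
  · rw [integral_jointLaw A h0 h1 i (integrable_roundRegret A h0 h1 i t),
      integral_jointLaw A h0 h1 i (integrable_one_sub_prob A h0 h1 i t), ← integral_const_mul]
    refine integral_congr_ae (ae_of_all _ fun s => ?_)
    have := sum_weight_mul_round_regret ε i ⟨t, ht⟩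
      (p := fun x => (A.act t s (bitHistory x t ht.le)).1)
      (fun x => (A.act t s (bitHistory x t ht.le)).2.2)
      (fun j x => by
        have := bitHistory_flipBit x ⟨t, ht⟩ j
        simp only at this
        simp only [this])
    simp only [roundRegret, lossVec_hardEnv, prob_hardEnv_of_le A h0 h1 i _ ht.le]
    simpa only [lossSeq, ht, dite_true, coe_bitLoss] using this
  · rw [one_mul]
    refine integral_congr_ae (ae_of_all _ fun ω => ?_)
    simp only [roundRegret, lossVec_hardEnv, lossSeq, ht, dite_false, if_true]
    have h := (prob A (hardEnv n h0 h1 i) ω t).2.2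
    rw [← Finset.add_sum_erase _ _ (Finset.mem_univ i)] at h ⊢
    have h' : ∑ j ∈ Finset.univ.erase i, (((if j = i then 0 else 1 : unitInterval) : ℝ) *
        (prob A (hardEnv n h0 h1 i) ω t).1 j) =
        ∑ j ∈ Finset.univ.erase i, (prob A (hardEnv n h0 h1 i) ω t).1 j :=
      Finset.sum_congr rfl fun j hj => by simp [Finset.ne_of_mem_erase hj]
    rw [h', if_pos rfl, Set.Icc.coe_zero, zero_mul]
    linarith

/-- The expected weight that the player does not put on action `i` in round `t`. -/
def expectedMiss (t : ℕ) : ℝ :=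
  ∫ ω, (1 - (prob A (hardEnv n h0 h1 i) ω t).1 i) ∂(jointLaw A (hardEnv n h0 h1 i))

lemma expectedMiss_nonneg (t : ℕ) : 0 ≤ expectedMiss (n := n) A h0 h1 i t :=
  integral_nonneg fun _ => sub_nonneg.2 (probVec_le_one _ i)

lemma expectedMiss_le_one (t : ℕ) : expectedMiss (n := n) A h0 h1 i t ≤ 1 := by
  have := integral_mono (integrable_one_sub_prob (n := n) A h0 h1 i t) (integrable_const (1 : ℝ))
    fun ω => sub_le_self 1 ((prob A (hardEnv n h0 h1 i) ω t).2.1 i)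
  simpa [expectedMiss] using this

lemma pseudoRegret_hardEnv (T : ℕ) :
    pseudoRegret A (hardEnv n h0 h1 i) T i =
      ∑ t ∈ Finset.range T, (if t < n then ε else 1) * expectedMiss (n := n) A h0 h1 i t := by
  simp only [pseudoRegret, regret_eq_sum]
  rw [integral_finsetSum _ fun t _ => integrable_roundRegret A h0 h1 i t]
  exact Finset.sum_congr rfl fun t _ => integral_roundRegret A h0 h1 i t

lemma sum_range_indicator_lt {T : ℕ} (hn : n ≤ T) (a : ℕ → ℝ) :
    ∑ t ∈ Finset.range T, (if t < n then a t else 0) = ∑ t ∈ Finset.range n, a t := by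
  rw [← Finset.sum_filter]
  congr 1
  ext t
  simp
  omega

/-- A biased round falls short by at most `max (Δ - ε) 0`, as the missing mass is at most `1`; later
rounds have gap `1 ≥ Δ` and cost nothing. -/
lemma hardEnv_selfBounding {T : ℕ} (hn : n ≤ T) {Δ C : ℝ} (hΔ : Δ ≤ 1)
    (hC : n * max (Δ - ε) 0 ≤ C) : (hardEnv n h0 h1 i).SelfBounding i Δ C T := by
  intro A
  rw [pseudoRegret_hardEnv, integral_finsetSum _ fun t _ => integrable_one_sub_prob A h0 h1 i t]
  change Δ * ∑ t ∈ Finset.range T, expectedMiss (n := n) A h0 h1 i t - C ≤ _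
  have h : ∀ t ∈ Finset.range T, Δ * expectedMiss (n := n) A h0 h1 i t ≤
      (if t < n then ε else 1) * expectedMiss (n := n) A h0 h1 i t +
        (if t < n then max (Δ - ε) 0 else 0) := by
    intro t _
    have ha := expectedMiss_nonneg (n := n) A h0 h1 i t
    have hb := expectedMiss_le_one (n := n) A h0 h1 i t
    split_ifs
    · nlinarith [le_max_left (Δ - ε) 0, le_max_right (Δ - ε) 0]
    · nlinarith
  have h2 := Finset.sum_le_sum h
  rw [Finset.sum_add_distrib, ← Finset.mul_sum, sum_range_indicator_lt hn, Finset.sum_const,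
    Finset.card_range, nsmul_eq_mul] at h2
  linarith

/-! ### Averaging over the favoured action -/

lemma expectedMiss_eq {t : ℕ} (ht : t < n) :
    expectedMiss (n := n) A h0 h1 i t =
      ∫ s, ∑ x, weight ε i x * (1 - (A.act t s (bitHistory (n := n) x t ht.le)).1 i)
        ∂A.seedLaw := by
  rw [expectedMiss, integral_jointLaw A h0 h1 i (integrable_one_sub_prob A h0 h1 i t)]
  simp only [prob_hardEnv_of_le A h0 h1 i _ ht.le]

lemma le_sum_expectedMiss {lam : ℝ} (hlam : 0 < lam) {t : ℕ} (ht : t < n) :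
    N - (lam + N * (1 + 4 * ε ^ 2) ^ n / lam) / 2 ≤
      ∑ i, expectedMiss (n := n) A h0 h1 i t := by
  have hint : ∀ i : Fin N, Integrable (fun s => ∑ x, weight ε i x *
      (1 - (A.act t s (bitHistory (n := n) x t ht.le)).1 i)) A.seedLaw := by
    intro i
    refine integrable_finsetSum _ fun x _ => Integrable.const_mul ?_ _
    have hm : Measurable fun s => A.act t s (bitHistory (n := n) x t ht.le) :=
      (A.measurable_act t).comp (measurable_id.prodMk measurable_const)
    have hm' : Measurable fun s => (A.act t s (bitHistory (n := n) x t ht.le)).1 i :=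
      (measurable_pi_apply i).comp (measurable_subtype_coe.comp hm)
    refine Integrable.of_bound (measurable_const.sub hm').aestronglyMeasurable 1
      (ae_of_all _ fun s => ?_)
    have := probVec_le_one (A.act t s (bitHistory (n := n) x t ht.le)) i
    have := (A.act t s (bitHistory (n := n) x t ht.le)).2.1 i
    rw [Real.norm_eq_abs, abs_le]
    constructor <;> linarith
  simp only [expectedMiss_eq A h0 h1 _ ht]
  rw [← integral_finsetSum _ fun i _ => hint i]
  have hmono := integral_mono (μ := A.seedLaw)
    (integrable_const ((N : ℝ) - (lam + N * (1 + 4 * ε ^ 2) ^ n / lam) / 2))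
    (integrable_finsetSum Finset.univ fun i _ => hint i) fun s => ?_
  · simpa using hmono
  · have := sum_sum_weight_mul_le ε hlam
      (p := fun x : Bits n N => (A.act t s (bitHistory x t ht.le)).1)
      (fun x => (A.act t s (bitHistory x t ht.le)).2.1)
      (fun x => (A.act t s (bitHistory x t ht.le)).2.2)
    simp only [mul_sub, mul_one, Finset.sum_sub_distrib, sum_weight]
    simp only [Finset.sum_const, Finset.card_univ, Fintype.card_fin, nsmul_eq_mul, mul_one]
    linarith

/-- Some action does at least as well as the average; the regret of rounds from `n` on is
nonnegative and is dropped. -/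
lemma exists_le_pseudoRegret {T : ℕ} (hn : n ≤ T) (hN : 0 < N) {lam : ℝ} (hlam : 0 < lam) :
    ∃ i, ε * n * (1 - (lam / N + (1 + 4 * ε ^ 2) ^ n / lam) / 2) ≤
      pseudoRegret A (hardEnv n h0 h1 i) T i := by
  have hNR : (0 : ℝ) < N := by exact_mod_cast hN
  have hne : (Finset.univ : Finset (Fin N)).Nonempty := ⟨⟨0, hN⟩, Finset.mem_univ _⟩
  have hreg : ∀ i, ε * ∑ t ∈ Finset.range n, expectedMiss (n := n) A h0 h1 i t ≤
      pseudoRegret A (hardEnv n h0 h1 i) T i := by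
    intro i
    rw [pseudoRegret_hardEnv, Finset.mul_sum, ← sum_range_indicator_lt hn]
    refine Finset.sum_le_sum fun t _ => ?_
    split_ifs
    · exact le_rfl
    · simpa using expectedMiss_nonneg (n := n) A h0 h1 i t
  obtain ⟨i, -, hi⟩ := Finset.exists_le_of_sum_le (s := Finset.univ)
    (f := fun _ : Fin N => ε * n * (1 - (lam / N + (1 + 4 * ε ^ 2) ^ n / lam) / 2))
    (g := fun i => ε * ∑ t ∈ Finset.range n, expectedMiss (n := n) A h0 h1 i t) hne (by
      rw [← Finset.mul_sum (f := fun i => ∑ t ∈ Finset.range n, expectedMiss (n := n) A h0 h1 i t),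
        Finset.sum_comm, Finset.sum_const, Finset.card_univ, Fintype.card_fin, nsmul_eq_mul]
      have := Finset.sum_le_sum fun t (ht : t ∈ Finset.range n) =>
        le_sum_expectedMiss A h0 h1 hlam (Finset.mem_range.1 ht)
      rw [Finset.sum_const, Finset.card_range, nsmul_eq_mul] at this
      refine le_trans (le_of_eq ?_) (mul_le_mul_of_nonneg_left this h0)
      field_simp)
  exact ⟨i, hi.trans (hreg i)⟩

end Game

/-! ### Choice of parameters -/

lemma pow_le_sqrt_of_sq_mul_le {ε x : ℝ} {n : ℕ} (hx : 0 < x) (h : ε ^ 2 * n ≤ Real.log x / 8) :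
    (1 + 4 * ε ^ 2) ^ n ≤ √x := by
  calc (1 + 4 * ε ^ 2) ^ n ≤ Real.exp (4 * ε ^ 2) ^ n :=
        pow_le_pow_left₀ (by positivity) (by linarith [Real.add_one_le_exp (4 * ε ^ 2)]) n
    _ = Real.exp (n * (4 * ε ^ 2)) := (Real.exp_nat_mul _ _).symm
    _ ≤ Real.exp (Real.log x / 2) := Real.exp_le_exp.2 (by linarith)
    _ = √x := by rw [Real.exp_half, Real.exp_log hx]

/-- Some hard environment with parameters `n` and `ε` forces regret at least `ε n / 4`. -/
lemma exists_quarter_le_pseudoRegret {N n T : ℕ} (A : Algorithm N) {ε : ℝ} (h0 : 0 ≤ ε)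
    (h1 : ε ≤ 1 / 2) (hN : 4 ≤ N) (hn : n ≤ T) (h : ε ^ 2 * n ≤ Real.log N / 8) :
    ∃ i, ε * n / 4 ≤ pseudoRegret A (hardEnv n h0 h1 i) T i := by
  have hNR : (4 : ℝ) ≤ N := by exact_mod_cast hN
  -- With `r = N^(1/4)`, the choice `lam = r ^ 3` balances both error terms at `1 / r`, and `N ≥ 4`
  -- gives `1 / r ≤ 3 / 4`.
  set r := √(√(N : ℝ)) with hr
  have hr0 : 0 < r := by positivity
  have hr2 : r ^ 2 = √(N : ℝ) := Real.sq_sqrt (Real.sqrt_nonneg _)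
  have hr4 : r ^ 4 = N := by
    rw [show r ^ 4 = (r ^ 2) ^ 2 by ring, hr2, Real.sq_sqrt (by linarith)]
  have hrlow : 4 / 3 ≤ r := by
    by_contra hlt
    have : r ^ 4 < (4 / 3) ^ 4 := pow_lt_pow_left₀ (not_le.1 hlt) hr0.le (by norm_num)
    norm_num at this
    linarith
  have hX := pow_le_sqrt_of_sq_mul_le (n := n) (ε := ε) (x := N) (by linarith) h
  rw [← hr2] at hX
  obtain ⟨i, hi⟩ := exists_le_pseudoRegret A h0 h1 hn (by omega) (lam := r ^ 3) (by positivity)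
  refine ⟨i, le_trans ?_ hi⟩
  have ha : r ^ 3 / (N : ℝ) = 1 / r := by
    rw [← hr4]
    field_simp
  have hb : (1 + 4 * ε ^ 2) ^ n / r ^ 3 ≤ 1 / r := by
    rw [div_le_div_iff₀ (by positivity) hr0]
    nlinarith
  have hc : 1 / r ≤ 3 / 4 := by
    rw [div_le_div_iff₀ hr0 (by norm_num)]
    linarith
  rw [ha, div_eq_mul_one_div]
  exact mul_le_mul_of_nonneg_left (by linarith) (by positivity)

/-- The number of rounds and the bias that make the hard environment self-bounding and its
regret large. -/
lemma exists_rounds_bias {L Δ C : ℝ} {T : ℕ} (hL : 1 ≤ L) (hΔ : 0 < Δ) (hΔ' : Δ < 1 / 4)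
    (hT : 4 * L ≤ T) (hC : 0 ≤ C) :
    ∃ (n : ℕ) (ε : ℝ), n ≤ T ∧ 0 ≤ ε ∧ ε ≤ 1 / 2 ∧ ε ^ 2 * n ≤ L / 8 ∧
      n * max (Δ - ε) 0 ≤ C ∧
      1 / 128 * min (L / Δ + √(C * L / Δ)) √(T * L) ≤ ε * n / 4 := by
  -- Up to the first bound on `n`, the bias `√(L / (8n))` is at least `Δ`; up to the second, `n * Δ
  -- ≤ C`.
  set M := max (L / (8 * Δ ^ 2)) (C / Δ) with hM
  have hΔ2 : Δ ^ 2 ≤ 1 / 16 := by nlinarith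
  -- Hence `M ≥ 2`, so rounding down loses at most a factor `2`; also `n ≥ L`, which keeps the bias
  -- below `1 / 2`.
  have hM1 : 2 * L ≤ L / (8 * Δ ^ 2) := by
    rw [le_div_iff₀ (by positivity)]
    nlinarith
  have hML : 2 * L ≤ M := hM1.trans (le_max_left _ _)
  have hfl : (⌊M⌋₊ : ℝ) ≤ M := Nat.floor_le (by linarith)
  have hfl' : M / 2 ≤ ⌊M⌋₊ := by linarith [Nat.lt_floor_add_one M]
  set n := min T ⌊M⌋₊ with hn
  have hnM : (n : ℝ) ≤ M := le_trans (by exact_mod_cast min_le_right _ _) hfl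
  have hnlow : min (T : ℝ) (M / 2) ≤ n := by
    rw [hn, Nat.cast_min]
    exact min_le_min_left _ hfl'
  have hLn : L ≤ n := le_trans (le_min (by linarith) (by linarith)) hnlow
  have hn0 : (0 : ℝ) < n := by linarith
  have hsq : √(L / (8 * n)) ^ 2 = L / (8 * n) := Real.sq_sqrt (by positivity)
  refine ⟨n, √(L / (8 * n)), min_le_left _ _, Real.sqrt_nonneg _, ?_, ?_, ?_, ?_⟩
  · rw [Real.sqrt_le_left (by norm_num), div_le_iff₀ (by positivity)]
    linarith
  · rw [hsq]
    apply le_of_eq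
    field_simp
  · rcases le_total (C / Δ) (L / (8 * Δ ^ 2)) with hcase | hcase
    · rw [hM, max_eq_left hcase, le_div_iff₀ (by positivity)] at hnM
      have : Δ ≤ √(L / (8 * n)) := by
        apply Real.le_sqrt_of_sq_le
        rw [le_div_iff₀ (by positivity)]
        linarith
      rw [max_eq_right (by linarith), mul_zero]
      exact hC
    · rw [hM, max_eq_right hcase, le_div_iff₀ hΔ] at hnM
      refine le_trans (mul_le_mul_of_nonneg_left ?_ hn0.le) hnM
      exact max_le (by linarith [Real.sqrt_nonneg (L / (8 * n))]) hΔ.le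
  · set ε := √(L / (8 * n)) with hε
    have hε0 : 0 ≤ ε := Real.sqrt_nonneg _
    have hεn : 8 * (ε * n) ^ 2 = n * L := by
      have : ε ^ 2 * n = L / 8 := by rw [hsq]; field_simp
      linear_combination (8 * (n : ℝ)) * this
    have hsqrt : √(n * L) ≤ 3 * (ε * n) := by
      apply Real.sqrt_le_left (by positivity) |>.2
      nlinarith [mul_nonneg hn0.le (by linarith : 0 ≤ L)]
    -- Together with `hsqrt` this bounds the minimum by `24 * (ε * n)`, within the `32 * (ε * n)`
    -- that `1 / 128` allows.
    suffices h : min (L / Δ + √(C * L / Δ)) √(T * L) ≤ 8 * √(n * L) by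
      linarith [mul_nonneg hε0 hn0.le]
    -- Either `n` reaches `T`, or `n ≥ M / 2` and each of the two summands is at most `4 * √(n *
    -- L)`.
    rcases min_le_iff.1 hnlow with h | h
    · refine (min_le_right _ _).trans ?_
      have : √(T * L) ≤ √(n * L) :=
        Real.sqrt_le_sqrt (mul_le_mul_of_nonneg_right h (by linarith))
      linarith [Real.sqrt_nonneg (n * L)]
    · refine (min_le_left _ _).trans ?_
      have ha : L / Δ ≤ 4 * √(n * L) := by
        have h1 : L / (8 * Δ ^ 2) ≤ 2 * n := (le_max_left _ _).trans (by linarith)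
        rw [div_le_iff₀ (by positivity)] at h1
        have h2 : L / (4 * Δ) ≤ √(n * L) := by
          apply Real.le_sqrt_of_sq_le
          rw [div_pow, div_le_iff₀ (by positivity)]
          nlinarith
        have h3 : L / (4 * Δ) = L / Δ / 4 := by field_simp
        linarith
      have hb : √(C * L / Δ) ≤ 4 * √(n * L) := by
        have h1 : C / Δ ≤ 2 * n := (le_max_right _ _).trans (by linarith)
        apply (Real.sqrt_le_left (by positivity)).2
        rw [mul_pow, Real.sq_sqrt (by positivity), mul_div_right_comm]
        nlinarith [mul_nonneg hn0.le (by linarith : 0 ≤ L)]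
      linarith

end Experts

end

theorem theorem5 :
    ∃ c : ℝ, 0 < c ∧
      ∀ (Δ : ℝ) (N T : ℕ) (C : ℝ), 0 < Δ → Δ < 1 / 4 → 4 ≤ N → 4 * Real.log N ≤ T → 0 ≤ C →
        ∀ A : Experts.Algorithm N, ∃ (E : Experts.Environment N) (i : Fin N),
          E.SelfBounding i Δ C T ∧
            c * min (Real.log N / Δ + Real.sqrt (C * Real.log N / Δ))
                (Real.sqrt (T * Real.log N)) ≤
              Experts.pseudoRegret A E T i := by
  refine ⟨1 / 128, by norm_num, fun Δ N T C hΔ hΔ' hN hT hC A => ?_⟩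
  have hL : 1 ≤ Real.log N := by
    rw [Real.le_log_iff_exp_le (by positivity)]
    have : (4 : ℝ) ≤ N := by exact_mod_cast hN
    linarith [Real.exp_one_lt_d9]
  obtain ⟨n, ε, hn, h0, h1, hεn, hself, hle⟩ := Experts.exists_rounds_bias hL hΔ hΔ' hT hC
  obtain ⟨i, hi⟩ := Experts.exists_quarter_le_pseudoRegret A h0 h1 hN hn hεn
  exact ⟨Experts.hardEnv n h0 h1 i, i,
    Experts.hardEnv_selfBounding h0 h1 i hn (by linarith) hself, hle.trans hi⟩
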